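/- Let $d\ge 1$, and let $(c_s)_{s\in\mathbb{Z}^d}\in\ell^1(\mathbb{Z}^d)$ be a real family such that \[ \sum_{s\in\mathbb{Z}^d}\|s\|_\infty^k\,|c_s|<\infty\qquad\text{for all } k\in\mathbb{N}. \] Let $(Y_t)_{t\in\mathbb{Z}^d}$ be a family of independent real-valued random variables on a common probability space that are standardized, $\mathbb{E}Y_t=0$ and $\mathbb{V}Y_t=1$ for all $t$, and whose moments are uniformly bounded: for every $k\in\mathbb{N}$ there is a constant $M'_k$ such that $\mathbb{E}|Y_t|^k\le M'_k$ for all $t\in\mathbb{Z}^d$. Define for all $t\in\mathbb{Z}^d$ \[ X_t:=\sum_{s\in\mathbb{Z}^d}c_sY_{t-s}, \] where the series converges absolutely almost surely, and let $B_n(0)=\{z\in\mathbb{Z}^d : \|z\|_\infty\le n\}$. Then the limit \[ \sigma^2:=\lim_{n\to\infty}\frac{1}{(2n+1)^d}\sum_{t,t'\in B_n(0)}\ \sum_{s\in\mathbb{Z}^d}c_{t-s}c_{t'-s} \] exists in $[0,\infty)$ (with all inner series absolutely convergent), and \[ \frac{1}{\sqrt{(2n+1)^d}}\sum_{t\in B_n(0)}X_t\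 \xrightarrow[n\to\infty]{}\ \mathcal{N}(0,\sigma^2)\qquad\text{weakly,} \] where $\mathcal{N}(0,\sigma^2):=\delta_0$ if $\sigma^2=0$. -/

import Mathlib

open MeasureTheory ProbabilityTheory Filter Topology
open scoped NNReal

/-- The box `B_n(0) = {z ∈ ℤ^d : ‖z‖_∞ ≤ n}`, as a finite set (see `mem_latticeBox`). -/
noncomputable def latticeBox (d n : ℕ) : Finset (Fin d → ℤ) :=
  Finset.Icc (fun _ => -(n : ℤ)) (fun _ => (n : ℤ))

/-- The norm on `Fin d → ℤ` is the supremum norm, and `latticeBox d n` is its closed ball. -/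
theorem mem_latticeBox (d n : ℕ) (z : Fin d → ℤ) :
    z ∈ latticeBox d n ↔ ‖z‖ ≤ (n : ℝ) := by
  rw [latticeBox, Finset.mem_Icc, pi_norm_le_iff_of_nonneg (Nat.cast_nonneg n),
    Pi.le_def, Pi.le_def, ← forall_and]
  refine forall_congr' fun i => ?_
  rw [Int.norm_eq_abs, ← abs_le]
  exact_mod_cast Iff.rfl

/-- The moving average random field `X_t = ∑_{s ∈ ℤ^d} c_s Y_{t-s}`, as a pointwise sum over
the sample space. -/
noncomputable def movingAverage {Ω : Type*} {d : ℕ} (c : (Fin d → ℤ) → ℝ)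
    (Y : (Fin d → ℤ) → Ω → ℝ) (t : Fin d → ℤ) (ω : Ω) : ℝ :=
  ∑' s : Fin d → ℤ, c s * Y (t - s) ω

/-! Interchanging sums, the box sum of `X` is the sum over `s` of `c s` times the sum of `Y` over
the box shifted by `-s`. A fixed shift changes only a vanishing proportion of the box, so after
normalization the sum of `X` is close in `L¹` to `∑' s, c s` times the sum of `Y`
(`lintegral_enorm_movingAverage_sub_le`), with `|c s| * √2` dominating the errors. Lyapunov's
theorem for `Y` and Slutsky's theorem give the Gaussian limit. The same overlap argument, applied to
the autocovariances, identifies `σ²` as `(∑' s, c s) ^ 2` (`tendsto_sum_latticeBox_covariance`). -/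

/-! ### Lyapunov's theorem by characteristic functions. -/

theorem norm_exp_mul_I_sub_quadratic_le (x : ℝ) :
    ‖Complex.exp (x * Complex.I) - (1 + x * Complex.I - (x : ℂ) ^ 2 / 2)‖ ≤ 4 * |x| ^ 3 := by
  rcases le_or_gt |x| 1 with hx | hx
  · have h := Complex.exp_bound (x := x * Complex.I) (by simpa using hx) (n := 3) (by norm_num)
    have e : ∑ m ∈ Finset.range 3, ((x : ℂ) * Complex.I) ^ m / (m.factorial : ℂ) =
        1 + x * Complex.I - (x : ℂ) ^ 2 / 2 := by
      simp [Finset.sum_range_succ, mul_pow, Nat.factorial]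
      ring
    rw [e] at h
    refine h.trans ?_
    have h0 : 0 ≤ |x| ^ 3 := by positivity
    simp only [norm_mul, Complex.norm_real, Complex.norm_I, mul_one, Real.norm_eq_abs]
    norm_num [Nat.factorial]
    nlinarith
  · have h1 : ‖Complex.exp (x * Complex.I)‖ = 1 := Complex.norm_exp_ofReal_mul_I x
    have h2 : ‖(1 + x * Complex.I - (x : ℂ) ^ 2 / 2)‖ ≤ 1 + |x| + |x| ^ 2 / 2 := by
      refine (norm_sub_le _ _).trans (add_le_add ((norm_add_le _ _).trans ?_) ?_)
      · simp
      · simp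
    refine (norm_sub_le _ _).trans ?_
    rw [h1]
    -- For `|x| > 1` the terms `1 + 1 + |x| + |x|²/2` total at most `7/2 * |x|³`, within the
    -- constant 4.
    have h3 : |x| ≤ |x| ^ 3 := le_self_pow₀ hx.le (by norm_num)
    have h4 : |x| ^ 2 ≤ |x| ^ 3 := pow_le_pow_right₀ hx.le (by norm_num)
    linarith

theorem norm_charFun_sub_quadratic_le {Ω : Type*} [MeasurableSpace Ω] {μ : Measure Ω}
    [IsProbabilityMeasure μ] {X : Ω → ℝ} (hX : Measurable X) (h1 : Integrable X μ)
    (h2 : Integrable (fun ω => X ω ^ 2) μ) (h3 : Integrable (fun ω => |X ω| ^ 3) μ)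
    (e1 : ∫ ω, X ω ∂μ = 0) (e2 : ∫ ω, X ω ^ 2 ∂μ = 1) (t : ℝ) :
    ‖charFun (μ.map X) t - (1 - (t : ℂ) ^ 2 / 2)‖ ≤ 4 * |t| ^ 3 * ∫ ω, |X ω| ^ 3 ∂μ := by
  have hexp : Integrable (fun ω => Complex.exp (((t * X ω : ℝ) : ℂ) * Complex.I)) μ := by
    refine Integrable.of_bound (by fun_prop) 1 (ae_of_all _ fun ω => ?_)
    exact (Complex.norm_exp_ofReal_mul_I _).le
  have e : charFun (μ.map X) t = ∫ ω, Complex.exp (((t * X ω : ℝ) : ℂ) * Complex.I) ∂μ := by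
    rw [charFun_apply_real, integral_map hX.aemeasurable (by fun_prop)]
    simp
  have i1 : Integrable (fun ω => (t * X ω : ℂ) * Complex.I) μ :=
    (h1.ofReal.const_mul _).mul_const _
  have i2 : Integrable (fun ω => (t * X ω : ℂ) ^ 2 / 2) μ := by
    have := (h2.ofReal (𝕜 := ℂ)).const_mul ((t : ℂ) ^ 2 / 2)
    refine this.congr (ae_of_all _ fun ω => ?_)
    simp
    ring
  have i12 : Integrable (fun ω => 1 + (t * X ω : ℂ) * Complex.I) μ := (integrable_const _).add i1
  have i3 : Integrable (fun ω => 1 + (t * X ω : ℂ) * Complex.I - (t * X ω : ℂ) ^ 2 / 2) μ :=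
    i12.sub i2
  have eq : ∫ ω, (1 + (t * X ω : ℂ) * Complex.I - (t * X ω : ℂ) ^ 2 / 2) ∂μ
      = 1 - (t : ℂ) ^ 2 / 2 := by
    rw [integral_sub i12 i2, integral_add (integrable_const _) i1]
    have a1 : ∫ ω, (t * X ω : ℂ) * Complex.I ∂μ = 0 := by
      rw [integral_mul_const, integral_const_mul, integral_complex_ofReal, e1]
      simp
    have a2 : ∫ ω, (t * X ω : ℂ) ^ 2 / 2 ∂μ = (t : ℂ) ^ 2 / 2 := by
      have : ∀ ω, (t * X ω : ℂ) ^ 2 / 2 = (t : ℂ) ^ 2 / 2 * ((X ω ^ 2 : ℝ) : ℂ) := fun ω => by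
        push_cast
        ring
      simp_rw [this]
      rw [integral_const_mul, integral_complex_ofReal, e2]
      simp
    rw [a1, a2]
    simp
  rw [e, ← eq, ← integral_sub hexp i3, ← integral_const_mul]
  refine norm_integral_le_of_norm_le (h3.const_mul _) (ae_of_all _ fun ω => ?_)
  have := norm_exp_mul_I_sub_quadratic_le (t * X ω)
  rw [abs_mul, mul_pow, ← mul_assoc] at this
  push_cast at this ⊢
  exact this

/-- Replace the factors one at a time: each swap costs at most `ε`, since the remaining factors have
norm at most 1. -/
theorem norm_prod_sub_pow_card_le {ι : Type*} (s : Finset ι) (a : ι → ℂ) (b : ℂ) {ε : ℝ}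
    (ha : ∀ i ∈ s, ‖a i‖ ≤ 1) (hb : ‖b‖ ≤ 1) (hab : ∀ i ∈ s, ‖a i - b‖ ≤ ε) :
    ‖∏ i ∈ s, a i - b ^ s.card‖ ≤ s.card * ε := by
  classical
  induction s using Finset.induction_on with
  | empty => simp
  | insert i s hi ih =>
    rw [Finset.prod_insert hi, Finset.card_insert_of_notMem hi]
    have ih' := ih (fun j hj => ha j (Finset.mem_insert_of_mem hj))
      (fun j hj => hab j (Finset.mem_insert_of_mem hj))
    have e : a i * ∏ j ∈ s, a j - b ^ (s.card + 1)
        = a i * (∏ j ∈ s, a j - b ^ s.card) + (a i - b) * b ^ s.card := by ring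
    rw [e]
    refine (norm_add_le _ _).trans ?_
    rw [norm_mul, norm_mul, norm_pow]
    have h1 := mul_le_of_le_one_left (norm_nonneg (∏ j ∈ s, a j - b ^ s.card))
      (ha i (Finset.mem_insert_self i s))
    have h2 := mul_le_of_le_one_right (norm_nonneg (a i - b))
      (pow_le_one₀ (norm_nonneg b) hb (n := s.card))
    have h3 := hab i (Finset.mem_insert_self i s)
    push_cast
    linarith

/-- Lyapunov's central limit theorem for standardized independent variables with uniformly bounded
third moments, summed along finite sets whose cardinality tends to infinity. -/
theorem tendstoInDistribution_inv_sqrt_card_mul_sum {Ω ι : Type*} [MeasurableSpace Ω]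
    {μ : Measure Ω} [IsProbabilityMeasure μ] {Y : ι → Ω → ℝ} {M : ℝ}
    (hm : ∀ i, Measurable (Y i)) (hindep : iIndepFun Y μ)
    (h2 : ∀ i, MemLp (Y i) 2 μ) (e1 : ∀ i, ∫ ω, Y i ω ∂μ = 0) (e2 : ∀ i, ∫ ω, Y i ω ^ 2 ∂μ = 1)
    (h3 : ∀ i, Integrable (fun ω => |Y i ω| ^ 3) μ) (hM : ∀ i, ∫ ω, |Y i ω| ^ 3 ∂μ ≤ M)
    {B : ℕ → Finset ι} (hB : Tendsto (fun n => (B n).card) atTop atTop) :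
    TendstoInDistribution (fun n ω => (√((B n).card : ℝ))⁻¹ * ∑ i ∈ B n, Y i ω) atTop
      (id : ℝ → ℝ) (fun _ => μ) (gaussianReal 0 1) where
  forall_aemeasurable n := by fun_prop
  aemeasurable_limit := by fun_prop
  tendsto := by
    refine ProbabilityMeasure.tendsto_iff_tendsto_charFun.2 fun t => ?_
    have hcf : ∀ n, charFun (μ.map (fun ω => (√((B n).card : ℝ))⁻¹ * ∑ i ∈ B n, Y i ω)) t
        = ∏ i ∈ B n, charFun (μ.map (Y i)) ((√((B n).card : ℝ))⁻¹ * t) := fun n => by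
      rw [charFun_map_mul_comp (by fun_prop),
        (hindep.restrict _).charFun_map_fun_finsetSum_eq_prod fun i _ => (hm i).aemeasurable]
      simp
    simp only [ProbabilityMeasure.coe_mk, Measure.map_id, charFun_gaussianReal, hcf]
    have hBr : Tendsto (fun n => ((B n).card : ℝ)) atTop atTop :=
      tendsto_natCast_atTop_atTop.comp hB
    have hsq : Tendsto (fun n => √((B n).card : ℝ)) atTop atTop :=
      Real.tendsto_sqrt_atTop.comp hBr
    have hlim : Tendsto (fun n => (1 + (-(t : ℂ) ^ 2 / 2) / ((B n).card : ℂ)) ^ (B n).card) atTop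
        (𝓝 (Complex.exp (-(t : ℂ) ^ 2 / 2))) :=
      (Complex.tendsto_one_add_div_pow_exp (-(t : ℂ) ^ 2 / 2)).comp hB
    have hdiff : Tendsto (fun n => ∏ i ∈ B n, charFun (μ.map (Y i)) ((√((B n).card : ℝ))⁻¹ * t)
        - (1 + (-(t : ℂ) ^ 2 / 2) / ((B n).card : ℂ)) ^ (B n).card) atTop (𝓝 0) := by
      have hz : Tendsto (fun n => (4 * |t| ^ 3 * M) * (√((B n).card : ℝ))⁻¹) atTop (𝓝 0) := by
        simpa using (tendsto_inv_atTop_zero.comp hsq).const_mul (4 * |t| ^ 3 * M)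
      refine squeeze_zero_norm' ?_ hz
      -- Once `N ≥ t²`, the factor `1 - t²/(2N)` lies in `[1/2, 1]`, as the product comparison
      -- needs.
      filter_upwards [hBr.eventually_ge_atTop 1, hBr.eventually_ge_atTop (t ^ 2)] with n hn1 hnt
      set N : ℝ := ((B n).card : ℝ) with hN
      have hN0 : 0 < N := by linarith
      have hs : √N ^ 2 = N := Real.sq_sqrt hN0.le
      have hs0 : 0 < √N := Real.sqrt_pos.2 hN0
      have hb : (1 + (-(t : ℂ) ^ 2 / 2) / ((B n).card : ℂ))
          = 1 - (((√N)⁻¹ * t : ℝ) : ℂ) ^ 2 / 2 := by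
        have : (((√N)⁻¹ * t : ℝ) : ℂ) ^ 2 = (t : ℂ) ^ 2 / ((B n).card : ℂ) := by
          have : ((√N)⁻¹ * t) ^ 2 = t ^ 2 / N := by
            rw [mul_pow, inv_pow, hs]
            ring
          rw [← Complex.ofReal_pow, this, hN]
          push_cast
          rfl
        rw [this]
        ring
      have hb1 : ‖1 - (((√N)⁻¹ * t : ℝ) : ℂ) ^ 2 / 2‖ ≤ 1 := by
        have e : ((√N)⁻¹ * t) ^ 2 = t ^ 2 / N := by
          rw [mul_pow, inv_pow, hs]
          ring
        have e' : (1 - (((√N)⁻¹ * t : ℝ) : ℂ) ^ 2 / 2) = ((1 - t ^ 2 / N / 2 : ℝ) : ℂ) := by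
          rw [← Complex.ofReal_pow, e]
          push_cast
          rfl
        rw [e', Complex.norm_real, Real.norm_eq_abs, abs_le]
        have q1 : t ^ 2 / N ≤ 1 := (div_le_one hN0).2 hnt
        have q2 : 0 ≤ t ^ 2 / N := by positivity
        constructor <;> linarith
      rw [hb]
      have key := norm_prod_sub_pow_card_le (B n)
        (fun i => charFun (μ.map (Y i)) ((√N)⁻¹ * t)) (1 - (((√N)⁻¹ * t : ℝ) : ℂ) ^ 2 / 2)
        (ε := 4 * |(√N)⁻¹ * t| ^ 3 * M) (fun i _ => ?_) hb1 (fun i _ => ?_)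
      -- `N` errors of order `N^(-3/2)` add up to order `N^(-1/2)`.
      · refine key.trans (le_of_eq ?_)
        rw [← hN, abs_mul, abs_of_pos (inv_pos.2 hs0)]
        nth_rewrite 1 [← hs]
        field_simp
      · have : IsProbabilityMeasure (μ.map (Y i)) :=
          Measure.isProbabilityMeasure_map (hm i).aemeasurable
        exact norm_charFun_le_one _
      · refine (norm_charFun_sub_quadratic_le (hm i) ((h2 i).integrable one_le_two)
          (h2 i).integrable_sq (h3 i) (e1 i) (e2 i) _).trans ?_
        exact mul_le_mul_of_nonneg_left (hM i) (by positivity)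
    have := hdiff.add hlim
    simp only [sub_add_cancel, zero_add] at this
    convert! this using 2
    simp [neg_div]

/-! ### Boxes and their overlap under shifts. -/

/-- The proportion of points of the box `B_n(0)` that stay in the box when shifted by `h`. -/
noncomputable def boxOverlap (d n : ℕ) (h : Fin d → ℤ) : ℝ :=
  (((latticeBox d n).filter fun t => t + h ∈ latticeBox d n).card : ℝ) / (2 * (n : ℝ) + 1) ^ d

theorem card_latticeBox (d n : ℕ) : (latticeBox d n).card = (2 * n + 1) ^ d := by
  rw [latticeBox, Pi.card_Icc]
  simp only [Int.card_Icc, Finset.prod_const, Finset.card_univ, Fintype.card_fin]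
  congr 1
  omega

theorem card_latticeBox_real (d n : ℕ) :
    ((latticeBox d n).card : ℝ) = (2 * (n : ℝ) + 1) ^ d := by
  rw [card_latticeBox]
  push_cast
  rfl

theorem boxOverlap_nonneg (d n : ℕ) (h : Fin d → ℤ) : 0 ≤ boxOverlap d n h := by
  unfold boxOverlap
  positivity

theorem boxOverlap_le_one (d n : ℕ) (h : Fin d → ℤ) : boxOverlap d n h ≤ 1 := by
  unfold boxOverlap
  rw [div_le_one (by positivity), ← card_latticeBox_real]
  exact_mod_cast Finset.card_filter_le _ _

/-- If `‖h‖ ≤ k`, the box of radius `n - k` stays in that of radius `n` after the shift, so the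
overlap is at least `(1 - 2k/(2n+1))^d`. -/
theorem tendsto_boxOverlap (d : ℕ) (h : Fin d → ℤ) :
    Tendsto (fun n => boxOverlap d n h) atTop (𝓝 1) := by
  obtain ⟨k, hk⟩ := exists_nat_ge ‖h‖
  have hlin : Tendsto (fun n : ℕ => 2 * (n : ℝ) + 1) atTop atTop :=
    tendsto_atTop_add_const_right _ _
      (tendsto_natCast_atTop_atTop.const_mul_atTop (by norm_num))
  have hlow : Tendsto (fun n : ℕ => (1 - 2 * (k : ℝ) / (2 * (n : ℝ) + 1)) ^ d) atTop (𝓝 1) := by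
    have := ((tendsto_const_nhds (x := (1 : ℝ))).sub
      ((tendsto_const_nhds (x := 2 * (k : ℝ))).div_atTop hlin)).pow d
    simpa using this
  refine tendsto_of_tendsto_of_tendsto_of_le_of_le' hlow tendsto_const_nhds ?_
    (Eventually.of_forall fun n => boxOverlap_le_one d n h)
  filter_upwards [eventually_ge_atTop k] with n hn
  have hsub : latticeBox d (n - k) ⊆
      (latticeBox d n).filter fun t => t + h ∈ latticeBox d n := by
    intro t ht
    rw [mem_latticeBox, Nat.cast_sub hn] at ht
    rw [Finset.mem_filter, mem_latticeBox, mem_latticeBox]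
    have hk0 : (0 : ℝ) ≤ k := Nat.cast_nonneg k
    exact ⟨by linarith, by linarith [norm_add_le t h]⟩
  have hcard : ((latticeBox d (n - k)).card : ℝ) ≤
      (((latticeBox d n).filter fun t => t + h ∈ latticeBox d n).card : ℝ) := by
    exact_mod_cast Finset.card_le_card hsub
  rw [card_latticeBox_real, Nat.cast_sub hn] at hcard
  unfold boxOverlap
  refine le_trans (le_of_eq ?_) (div_le_div_of_nonneg_right hcard (by positivity))
  rw [← div_pow]
  congr 1
  field_simp
  ring

/-! ### The limiting variance. -/

section Covariance

variable {d : ℕ} {c : (Fin d → ℤ) → ℝ}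

/-- The bijection `(h, u) ↦ (u, u + h)` reduces this to the product of two absolutely convergent
series. -/
theorem summable_mul_shift (hc : Summable fun s => |c s|) :
    Summable fun p : (Fin d → ℤ) × (Fin d → ℤ) => c p.2 * c (p.2 + p.1) := by
  have hn : Summable fun s => ‖c s‖ := hc
  have h := summable_mul_of_summable_norm hn hn
  let e : (Fin d → ℤ) × (Fin d → ℤ) ≃ (Fin d → ℤ) × (Fin d → ℤ) :=
    { toFun := fun p => (p.2, p.2 + p.1)
      invFun := fun q => (q.2 - q.1, q.1)
      left_inv := fun p => by simp
      right_inv := fun q => by simp }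
  exact e.summable_iff.2 h

theorem tsum_tsum_mul_shift (hc : Summable fun s => |c s|) :
    ∑' h, ∑' u, c u * c (u + h) = (∑' s, c s) ^ 2 := by
  have hn : Summable fun s => ‖c s‖ := hc
  have hs := summable_mul_shift hc
  rw [← hs.tsum_prod, sq, tsum_mul_tsum_of_summable_norm hn hn]
  let e : (Fin d → ℤ) × (Fin d → ℤ) ≃ (Fin d → ℤ) × (Fin d → ℤ) :=
    { toFun := fun p => (p.2, p.2 + p.1)
      invFun := fun q => (q.2 - q.1, q.1)
      left_inv := fun p => by simp
      right_inv := fun q => by simp }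
  exact e.tsum_eq fun q : (Fin d → ℤ) × (Fin d → ℤ) => c q.1 * c q.2

theorem summable_mul_sub (hc : Summable fun s => |c s|) (t t' : Fin d → ℤ) :
    Summable fun s => c (t - s) * c (t' - s) := by
  have h := (summable_mul_shift hc).prod_factor (t' - t)
  rw [← (Equiv.subLeft t).summable_iff] at h
  refine h.congr fun s => ?_
  simp

theorem tsum_mul_sub (t t' : Fin d → ℤ) :
    ∑' s, c (t - s) * c (t' - s) = ∑' u, c u * c (u + (t' - t)) := by
  rw [← (Equiv.subLeft t).tsum_eq]
  refine tsum_congr fun s => ?_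
  have e : t' - (t - s) = s + (t' - t) := by abel
  rw [Equiv.subLeft_apply, sub_sub_cancel, e]

/-- Pairs are grouped by their difference `h = t' - t`; the number of `t` giving `h` is the overlap
count. -/
theorem sum_latticeBox_covariance {r : (Fin d → ℤ) → ℝ} (hr : Summable r) (n : ℕ) :
    1 / (2 * (n : ℝ) + 1) ^ d * ∑ t ∈ latticeBox d n, ∑ t' ∈ latticeBox d n, r (t' - t)
      = ∑' h, r h * boxOverlap d n h := by
  have h1 : ∀ t, ∑ t' ∈ latticeBox d n, r (t' - t)
      = ∑' h, r h * if t + h ∈ latticeBox d n then 1 else 0 := fun t => by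
    rw [← (Equiv.subRight t).tsum_eq,
      tsum_eq_sum (s := latticeBox d n) fun b hb => by simp [hb]]
    exact Finset.sum_congr rfl fun t' ht' => by simp [ht']
  have hs : ∀ t, Summable fun h => r h * if t + h ∈ latticeBox d n then (1 : ℝ) else 0 := fun t =>
    Summable.of_norm_bounded hr.norm fun h => by
      split_ifs <;> simp
  simp_rw [h1]
  rw [← Summable.tsum_finsetSum fun t _ => hs t, ← tsum_mul_left]
  refine tsum_congr fun h => ?_
  rw [← Finset.mul_sum, Finset.sum_boole, boxOverlap]
  ring

theorem tendsto_sum_latticeBox_covariance (hc : Summable fun s => |c s|) :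
    Tendsto (fun n : ℕ => 1 / (2 * (n : ℝ) + 1) ^ d *
      ∑ t ∈ latticeBox d n, ∑ t' ∈ latticeBox d n, ∑' s, c (t - s) * c (t' - s))
      atTop (𝓝 ((∑' s, c s) ^ 2)) := by
  have hr : Summable fun h => ∑' u, c u * c (u + h) := (summable_mul_shift hc).prod
  simp_rw [tsum_mul_sub]
  simp_rw [sum_latticeBox_covariance hr]
  rw [← tsum_tsum_mul_shift hc]
  refine tendsto_tsum_of_dominated_convergence hr.norm (fun h => ?_)
    (Eventually.of_forall fun n h => ?_)
  · simpa using (tendsto_boxOverlap d h).const_mul (∑' u, c u * c (u + h))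
  · rw [norm_mul, Real.norm_of_nonneg (boxOverlap_nonneg d n h)]
    exact mul_le_of_le_one_right (norm_nonneg _) (boxOverlap_le_one d n h)

end Covariance

/-! ### Comparison of the moving average with the innovations in `L¹`. -/

section Orthonormal

variable {Ω : Type*} [MeasurableSpace Ω] {μ : Measure Ω}

theorem integral_mul_of_standardized {ι : Type*} [DecidableEq ι] {Y : ι → Ω → ℝ}
    (hindep : iIndepFun Y μ) (h2 : ∀ i, MemLp (Y i) 2 μ) (e1 : ∀ i, ∫ ω, Y i ω ∂μ = 0)
    (e2 : ∀ i, ∫ ω, Y i ω ^ 2 ∂μ = 1) (i j : ι) :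
    ∫ ω, Y i ω * Y j ω ∂μ = if i = j then 1 else 0 := by
  split_ifs with h
  · subst h
    simpa [sq] using e2 i
  · rw [(hindep.indepFun h).integral_fun_mul_eq_mul_integral (h2 i).aestronglyMeasurable
      (h2 j).aestronglyMeasurable, e1 i, zero_mul]

theorem integral_sum_mul_sum_of_standardized {ι κ : Type*} [DecidableEq ι] {Y : ι → Ω → ℝ}
    (hindep : iIndepFun Y μ) (h2 : ∀ i, MemLp (Y i) 2 μ) (e1 : ∀ i, ∫ ω, Y i ω ∂μ = 0)
    (e2 : ∀ i, ∫ ω, Y i ω ^ 2 ∂μ = 1) (S : Finset κ) (f g : κ → ι) :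
    ∫ ω, (∑ a ∈ S, Y (f a) ω) * (∑ b ∈ S, Y (g b) ω) ∂μ
      = ∑ a ∈ S, ∑ b ∈ S, if f a = g b then 1 else 0 := by
  have hint : ∀ i j, Integrable (fun ω => Y i ω * Y j ω) μ := fun i j =>
    (h2 i).integrable_mul (h2 j)
  simp_rw [Finset.sum_mul_sum]
  rw [integral_finsetSum _ fun a _ => integrable_finsetSum _ fun b _ => hint _ _]
  refine Finset.sum_congr rfl fun a _ => ?_
  rw [integral_finsetSum _ fun b _ => hint _ _]
  exact Finset.sum_congr rfl fun b _ => integral_mul_of_standardized hindep h2 e1 e2 _ _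

variable {d : ℕ} {Y : (Fin d → ℤ) → Ω → ℝ}

/-- By orthonormality each square contributes the box cardinality, while the cross term counts the
`t` with both `t` and `t - s` in the box. -/
theorem integral_sq_sum_shift_sub (hindep : iIndepFun Y μ) (h2 : ∀ i, MemLp (Y i) 2 μ)
    (e1 : ∀ i, ∫ ω, Y i ω ∂μ = 0) (e2 : ∀ i, ∫ ω, Y i ω ^ 2 ∂μ = 1) (n : ℕ) (s : Fin d → ℤ) :
    ∫ ω, (∑ t ∈ latticeBox d n, (Y (t - s) ω - Y t ω)) ^ 2 ∂μ
      = (2 * (n : ℝ) + 1) ^ d * (2 - 2 * boxOverlap d n (-s)) := by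
  classical
  set B := latticeBox d n with hB
  have hM : ∀ f : (Fin d → ℤ) → (Fin d → ℤ), MemLp (fun ω => ∑ t ∈ B, Y (f t) ω) 2 μ := fun f =>
    memLp_finsetSum _ fun t _ => h2 _
  have hI : ∀ f g : (Fin d → ℤ) → (Fin d → ℤ),
      Integrable (fun ω => (∑ t ∈ B, Y (f t) ω) * (∑ t ∈ B, Y (g t) ω)) μ := fun f g =>
    (hM f).integrable_mul (hM g)
  have hexp : ∀ ω, (∑ t ∈ B, (Y (t - s) ω - Y t ω)) ^ 2
      = (∑ t ∈ B, Y (t - s) ω) * (∑ t ∈ B, Y (t - s) ω)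
        + (∑ t ∈ B, Y t ω) * (∑ t ∈ B, Y t ω)
        - 2 * ((∑ t ∈ B, Y (t - s) ω) * (∑ t ∈ B, Y t ω)) := fun ω => by
    rw [Finset.sum_sub_distrib]
    ring
  have i1 := hI (fun t => t - s) (fun t => t - s)
  have i2 := hI (fun t => t) (fun t => t)
  have i3 := hI (fun t => t - s) (fun t => t)
  have i12 : Integrable (fun ω => (∑ t ∈ B, Y (t - s) ω) * (∑ t ∈ B, Y (t - s) ω)
        + (∑ t ∈ B, Y t ω) * (∑ t ∈ B, Y t ω)) μ := i1.add i2
  simp_rw [hexp]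
  rw [integral_sub i12 (i3.const_mul 2), integral_add i1 i2, integral_const_mul]
  have q1 := integral_sum_mul_sum_of_standardized hindep h2 e1 e2 B (fun t => t - s) (fun t => t - s)
  have q2 := integral_sum_mul_sum_of_standardized hindep h2 e1 e2 B (fun t => t) (fun t => t)
  have q3 := integral_sum_mul_sum_of_standardized hindep h2 e1 e2 B (fun t => t - s) (fun t => t)
  simp only [sub_left_inj, Finset.sum_ite_eq, Finset.sum_ite_mem, Finset.inter_self, Finset.sum_const, nsmul_eq_mul, mul_one,
    Finset.sum_boole] at q1 q2 q3
  rw [q1, q2, q3, boxOverlap, ← card_latticeBox_real, ← hB]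
  have hN : (B.card : ℝ) ≠ 0 := by
    rw [hB, card_latticeBox_real]
    positivity
  simp only [← sub_eq_add_neg]
  field_simp
  ring

theorem integral_abs_le_sqrt_integral_sq [IsProbabilityMeasure μ] {X : Ω → ℝ} (h : MemLp X 2 μ) :
    ∫ ω, |X ω| ∂μ ≤ √(∫ ω, X ω ^ 2 ∂μ) := by
  refine Real.le_sqrt_of_sq_le ?_
  have := variance_nonneg |X| μ
  rw [variance_eq_sub h.abs] at this
  simp only [Pi.pow_apply, Pi.abs_apply, sq_abs] at this
  linarith

theorem integral_abs_sum_shift_sub_le [IsProbabilityMeasure μ] (hindep : iIndepFun Y μ)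
    (h2 : ∀ i, MemLp (Y i) 2 μ) (e1 : ∀ i, ∫ ω, Y i ω ∂μ = 0)
    (e2 : ∀ i, ∫ ω, Y i ω ^ 2 ∂μ = 1) (n : ℕ) (s : Fin d → ℤ) :
    1 / √((2 * (n : ℝ) + 1) ^ d) * ∫ ω, |∑ t ∈ latticeBox d n, (Y (t - s) ω - Y t ω)| ∂μ
      ≤ √(2 - 2 * boxOverlap d n (-s)) := by
  have hM : MemLp (fun ω => ∑ t ∈ latticeBox d n, (Y (t - s) ω - Y t ω)) 2 μ :=
    memLp_finsetSum _ fun t _ => (h2 _).sub (h2 _)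
  have h := integral_abs_le_sqrt_integral_sq hM
  have hN : (0 : ℝ) < (2 * (n : ℝ) + 1) ^ d := by positivity
  rw [integral_sq_sum_shift_sub hindep h2 e1 e2, Real.sqrt_mul hN.le] at h
  rw [one_div, inv_mul_le_iff₀ (Real.sqrt_pos.2 hN)]
  exact h

variable {c : (Fin d → ℤ) → ℝ}

/-- The terms have `L¹` norms at most `|c s|`, which are summable. -/
theorem ae_summable_movingAverage [IsProbabilityMeasure μ] (hc : Summable fun s => |c s|)
    (h2 : ∀ i, MemLp (Y i) 2 μ) (e2 : ∀ i, ∫ ω, Y i ω ^ 2 ∂μ = 1) (t : Fin d → ℤ) :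
    ∀ᵐ ω ∂μ, Summable fun s => c s * Y (t - s) ω := by
  have hI : ∀ s, Integrable (fun ω => c s * Y (t - s) ω) μ := fun s =>
    ((h2 _).integrable one_le_two).const_mul _
  have hb : ∀ s, eLpNorm (fun ω => c s * Y (t - s) ω) 1 μ ≤ ENNReal.ofReal |c s| := fun s => by
    rw [eLpNorm_one_eq_lintegral_enorm, ← ofReal_integral_norm_eq_lintegral_enorm (hI s)]
    refine ENNReal.ofReal_le_ofReal ?_
    simp_rw [norm_mul, Real.norm_eq_abs]
    rw [integral_const_mul]
    refine mul_le_of_le_one_right (abs_nonneg _) ?_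
    simpa [e2] using integral_abs_le_sqrt_integral_sq (h2 (t - s))
  have hfin : ∑' s, eLpNorm (fun ω => c s * Y (t - s) ω) 1 μ ≠ ⊤ := by
    refine ne_top_of_le_ne_top ?_ (ENNReal.tsum_le_tsum hb)
    rw [← ENNReal.ofReal_tsum_of_nonneg (fun s => abs_nonneg _) hc]
    exact ENNReal.ofReal_ne_top
  filter_upwards [summable_norm_of_tsum_eLpNorm_ne_top le_rfl
    (fun s => (hI s).aestronglyMeasurable) hfin] with ω hω
  exact hω.of_norm

theorem measurable_movingAverage (hm : ∀ i, Measurable (Y i)) (t : Fin d → ℤ) :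
    Measurable (movingAverage c Y t) :=
  Measurable.tsum fun s => (hm (t - s)).const_mul (c s)

/-- The `L¹` distance between the normalized box sum of the moving average and the normalized box
sum of the innovations times the total mass of `c`. -/
theorem lintegral_enorm_movingAverage_sub_le [IsProbabilityMeasure μ]
    (hc : Summable fun s => |c s|) (hindep : iIndepFun Y μ)
    (h2 : ∀ i, MemLp (Y i) 2 μ) (e1 : ∀ i, ∫ ω, Y i ω ∂μ = 0)
    (e2 : ∀ i, ∫ ω, Y i ω ^ 2 ∂μ = 1) (n : ℕ) :
    ∫⁻ ω, ‖1 / √((2 * (n : ℝ) + 1) ^ d) * ∑ t ∈ latticeBox d n, movingAverage c Y t ω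
        - (∑' s, c s) * ((√((2 * (n : ℝ) + 1) ^ d))⁻¹ * ∑ t ∈ latticeBox d n, Y t ω)‖ₑ ∂μ
      ≤ ENNReal.ofReal (∑' s, |c s| * √(2 - 2 * boxOverlap d n (-s))) := by
  set K : ℝ := 1 / √((2 * (n : ℝ) + 1) ^ d) with hK
  have hK0 : 0 ≤ K := by positivity
  set B := latticeBox d n with hB
  have hI : ∀ s, Integrable (fun ω => c s * (K * ∑ t ∈ B, (Y (t - s) ω - Y t ω))) μ := fun s =>
    ((integrable_finsetSum _ fun t _ => ((h2 _).integrable one_le_two).sub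
      ((h2 _).integrable one_le_two)).const_mul _).const_mul _
  have hsq : ∀ s, √(2 - 2 * boxOverlap d n (-s)) ≤ √2 := fun s =>
    Real.sqrt_le_sqrt (by linarith [boxOverlap_nonneg d n (-s)])
  have hsum : Summable fun s => |c s| * √(2 - 2 * boxOverlap d n (-s)) :=
    (hc.mul_right √2).of_nonneg_of_le (fun s => by positivity)
      fun s => mul_le_mul_of_nonneg_left (hsq s) (abs_nonneg _)
  -- The lattice is countable, so one null set serves all `t`.
  have hall : ∀ᵐ ω ∂μ, ∀ t, Summable fun s => c s * Y (t - s) ω :=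
    ae_all_iff.2 fun t => ae_summable_movingAverage hc h2 e2 t
  have hcs : Summable c := hc.of_abs
  calc _ = ∫⁻ ω, ‖∑' s, c s * (K * ∑ t ∈ B, (Y (t - s) ω - Y t ω))‖ₑ ∂μ := by
        refine lintegral_congr_ae ?_
        filter_upwards [hall] with ω hω
        congr 1
        simp only [movingAverage]
        rw [← Summable.tsum_finsetSum fun t _ => hω t, ← tsum_mul_left, ← tsum_mul_right,
          ← Summable.tsum_sub ((summable_sum fun t _ => hω t).mul_left _) (hcs.mul_right _)]
        refine tsum_congr fun s => ?_
        rw [← Finset.mul_sum, Finset.sum_sub_distrib, hK]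
        ring
    _ ≤ ∫⁻ ω, ∑' s, ‖c s * (K * ∑ t ∈ B, (Y (t - s) ω - Y t ω))‖ₑ ∂μ :=
        lintegral_mono fun ω => enorm_tsum_le_tsum_enorm
    _ = ∑' s, ∫⁻ ω, ‖c s * (K * ∑ t ∈ B, (Y (t - s) ω - Y t ω))‖ₑ ∂μ :=
        lintegral_tsum fun s => (hI s).aestronglyMeasurable.enorm
    _ ≤ ∑' s, ENNReal.ofReal (|c s| * √(2 - 2 * boxOverlap d n (-s))) := by
        refine ENNReal.tsum_le_tsum fun s => ?_
        rw [← ofReal_integral_norm_eq_lintegral_enorm (hI s)]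
        refine ENNReal.ofReal_le_ofReal ?_
        simp_rw [norm_mul, Real.norm_eq_abs, abs_of_nonneg hK0]
        rw [integral_const_mul, integral_const_mul]
        exact mul_le_mul_of_nonneg_left
          (integral_abs_sum_shift_sub_le hindep h2 e1 e2 n s) (abs_nonneg _)
    _ = _ := (ENNReal.ofReal_tsum_of_nonneg (fun s => by positivity) hsum).symm

theorem tendsto_tsum_abs_mul_sqrt_boxOverlap (hc : Summable fun s => |c s|) :
    Tendsto (fun n => ∑' s, |c s| * √(2 - 2 * boxOverlap d n (-s))) atTop (𝓝 0) := by
  have h : Tendsto (fun n => ∑' s, |c s| * √(2 - 2 * boxOverlap d n (-s))) atTop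
      (𝓝 (∑' _ : Fin d → ℤ, (0 : ℝ))) := by
    refine tendsto_tsum_of_dominated_convergence (hc.mul_right √2) (fun s => ?_)
      (Eventually.of_forall fun n s => ?_)
    · have := (((tendsto_boxOverlap d (-s)).const_mul 2).const_sub 2).sqrt.const_mul |c s|
      simpa using this
    · rw [Real.norm_of_nonneg (by positivity)]
      exact mul_le_mul_of_nonneg_left
        (Real.sqrt_le_sqrt (by linarith [boxOverlap_nonneg d n (-s)])) (abs_nonneg _)
  simpa using h

theorem tendstoInMeasure_movingAverage_sub [IsProbabilityMeasure μ]
    (hc : Summable fun s => |c s|) (hm : ∀ i, Measurable (Y i)) (hindep : iIndepFun Y μ)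
    (h2 : ∀ i, MemLp (Y i) 2 μ) (e1 : ∀ i, ∫ ω, Y i ω ∂μ = 0)
    (e2 : ∀ i, ∫ ω, Y i ω ^ 2 ∂μ = 1) :
    TendstoInMeasure μ (fun (n : ℕ) ω =>
      1 / √((2 * (n : ℝ) + 1) ^ d) * ∑ t ∈ latticeBox d n, movingAverage c Y t ω
        - (∑' s, c s) * ((√((2 * (n : ℝ) + 1) ^ d))⁻¹ * ∑ t ∈ latticeBox d n, Y t ω))
      atTop 0 := by
  have hma := fun t => measurable_movingAverage (c := c) hm t
  refine tendstoInMeasure_of_tendsto_eLpNorm one_ne_zero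
    (fun n => Measurable.aestronglyMeasurable (by fun_prop)) aestronglyMeasurable_zero ?_
  simp_rw [sub_zero, eLpNorm_one_eq_lintegral_enorm]
  have h := ENNReal.tendsto_ofReal (tendsto_tsum_abs_mul_sqrt_boxOverlap hc)
  rw [ENNReal.ofReal_zero] at h
  exact tendsto_of_tendsto_of_tendsto_of_le_of_le tendsto_const_nhds h (fun n => zero_le)
    fun n => lintegral_enorm_movingAverage_sub_le hc hindep h2 e1 e2 n

end Orthonormal

/-! ### Assembly of the limit theorem. -/

theorem corollary3 {Ω : Type*} [MeasurableSpace Ω] (μ : Measure Ω) [IsProbabilityMeasure μ]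
    (d : ℕ) (hd : 1 ≤ d)
    (c : (Fin d → ℤ) → ℝ)
    (hc : Summable fun s : Fin d → ℤ => |c s|)
    (hcdecay : ∀ k : ℕ, 1 ≤ k → Summable fun s : Fin d → ℤ => ‖s‖ ^ k * |c s|)
    (Y : (Fin d → ℤ) → Ω → ℝ)
    (hYmeas : ∀ t, Measurable (Y t))
    (hYindep : iIndepFun Y μ)
    (hYmean : ∀ t, ∫ ω, Y t ω ∂μ = 0)
    (hYvar : ∀ t, variance (Y t) μ = 1)
    (hYmoments : ∀ k : ℕ, 1 ≤ k → ∃ M : ℝ, ∀ t,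
      Integrable (fun ω => |Y t ω| ^ k) μ ∧ ∫ ω, |Y t ω| ^ k ∂μ ≤ M) :
    (∀ t, ∀ᵐ ω ∂μ, Summable fun s : Fin d → ℤ => c s * Y (t - s) ω) ∧
    (∀ t t' : Fin d → ℤ, Summable fun s : Fin d → ℤ => c (t - s) * c (t' - s)) ∧
    ∃ σsq : ℝ≥0,
      Tendsto (fun n : ℕ => 1 / (2 * (n : ℝ) + 1) ^ d *
          ∑ t ∈ latticeBox d n, ∑ t' ∈ latticeBox d n,
            ∑' s : Fin d → ℤ, c (t - s) * c (t' - s))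
        atTop (𝓝 (σsq : ℝ)) ∧
      TendstoInDistribution
        (fun (n : ℕ) (ω : Ω) => 1 / √((2 * (n : ℝ) + 1) ^ d) *
          ∑ t ∈ latticeBox d n, movingAverage c Y t ω)
        atTop (id : ℝ → ℝ) (fun _ => μ) (gaussianReal 0 σsq) := by
  have e2 : ∀ t, ∫ ω, Y t ω ^ 2 ∂μ = 1 := fun t => by
    rw [← variance_of_integral_eq_zero (hYmeas t).aemeasurable (hYmean t)]
    exact hYvar t
  -- `variance` takes the value 0 outside `L²`, so variance 1 forces square integrability.
  have h2 : ∀ t, MemLp (Y t) 2 μ := fun t =>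
    memLp_two_of_variance_ne_zero (hYmeas t).aestronglyMeasurable (by simp [hYvar t])
  obtain ⟨M, hM⟩ := hYmoments 3 (by norm_num)
  refine ⟨ae_summable_movingAverage hc h2 e2, summable_mul_sub hc,
    NNReal.mk ((∑' s, c s) ^ 2) (sq_nonneg _), tendsto_sum_latticeBox_covariance hc, ?_⟩
  have hcard : Tendsto (fun n => (latticeBox d n).card) atTop atTop := by
    refine tendsto_atTop_mono (fun n => ?_) tendsto_id
    rw [card_latticeBox]
    -- Here `d ≠ 0` is essential: for `d = 0` the box is a single point.
    exact le_trans (by simp; omega) (Nat.le_self_pow (by omega) (2 * n + 1))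
  have hclt := tendstoInDistribution_inv_sqrt_card_mul_sum hYmeas hYindep h2 hYmean e2
    (fun t => (hM t).1) (fun t => (hM t).2) hcard
  simp_rw [card_latticeBox_real] at hclt
  have hscaled := hclt.continuous_comp (g := fun x => (∑' s, c s) * x) (by fun_prop)
  -- This includes `∑' s, c s = 0`, where both sides are the Dirac mass at 0.
  have hmap : (gaussianReal 0 1).map (fun x => (∑' s, c s) * x) =
      gaussianReal 0 (NNReal.mk ((∑' s, c s) ^ 2) (sq_nonneg _)) := by
    rw [gaussianReal_map_const_mul]
    simp
  have hlim : TendstoInDistribution (fun (n : ℕ) (ω : Ω) =>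
      (∑' s, c s) * ((√((2 * (n : ℝ) + 1) ^ d))⁻¹ * ∑ t ∈ latticeBox d n, Y t ω))
      atTop (id : ℝ → ℝ) (fun _ => μ)
      (gaussianReal 0 (NNReal.mk ((∑' s, c s) ^ 2) (sq_nonneg _))) :=
    { forall_aemeasurable := hscaled.forall_aemeasurable
      aemeasurable_limit := by fun_prop
      tendsto := by
        convert! hscaled.tendsto using 2
        exact congrArg 𝓝 (Subtype.ext (Measure.map_id.trans hmap.symm)) }
  have hma := fun t => measurable_movingAverage (c := c) hYmeas t
  -- Slutsky: a difference tending to 0 in measure does not change the limit law.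
  exact tendstoInDistribution_of_tendstoInMeasure_sub _ _ hlim
    (tendstoInMeasure_movingAverage_sub hc hYmeas hYindep h2 hYmean e2)
    (fun n => Measurable.aemeasurable (by fun_prop))
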